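/- Let $\mathcal V$ be a complex vector space, $\mathcal V_{\rm nc}=\coprod_{n\ge 1}\mathcal V^{n\times n}$, and let $\Omega\subset\mathcal V_{\rm nc}$ be a finite set; write $\Omega_n=\Omega\cap\mathcal V^{n\times n}$. Let $\mathcal A$ be a unital $C^*$-algebra, $\mathbb S\subset\mathcal A$ an operator system (a linear subspace with $1_{\mathcal A}\in\mathbb S$ and $\mathbb S^*=\mathbb S$), and $\mathcal Y$ a complex Hilbert space with bounded operators $\mathcal L(\mathcal Y)$. For $\mathbb E=\mathbb S$ or $\mathbb E=\mathcal A$, a *nc kernel* $K\colon\Omega\times\Omega\to\mathcal L(\mathbb E_{\rm nc},\mathcal L(\mathcal Y)_{\rm nc})$ is a function assigning to $Z\in\Omega_n$, $W\in\Omega_m$ a linear map $K(Z,W)\colon\mathbb E^{n\times m}\to\mathcal L(\mathcal Y)^{n\times m}$, such that whenever $Z\in\Omega_n$, $\widetilde Z\in\Omega_{\tilde n}$, $W\in\Omega_m$, $\widetilde W\in\Omega_{\tilde m}$, $\alpha\in\mathbb C^{\tilde n\times n}$, $\beta\in\mathbb C^{\tilde m\times m}$ satisfy $\alpha Z=\widetilde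 Z\alpha$ and $\beta W=\widetilde W\beta$, one has $$\alpha\,K(Z,W)(P)\,\beta^*=K(\widetilde Z,\widetilde W)(\alpha P\beta^*)\qquad\text{for all }P\in\mathbb E^{n\times m}.$$ It is *completely positive* (a *cp nc kernel*) if for all $Z_1,\dots,Z_r\in\Omega$ with $Z_i\in\Omega_{n_i}$, setting $N=n_1+\dots+n_r$, the map $[P_{ij}]\mapsto[K(Z_i,Z_j)(P_{ij})]$ (where $P_{ij}\in\mathbb E^{n_i\times n_j}$) from $\mathbb E^{N\times N}$ to $\mathcal L(\mathcal Y)^{N\times N}\cong\mathcal L(\mathcal Y^N)$ is completely positive, where a matrix over $\mathbb E$ is positive if it is positive as a matrix over $\mathcal A$. **Theorem.** Let $K\colon\Omega\times\Omega\to\mathcal L(\mathbb S_{\rm nc},\mathcal L(\mathcal Y)_{\rm nc})$ be a cp nc kernel. Then there exists a cp nc kernel $\widehat K\colon\Omega\times\Omega\to\mathcal L(\mathcal A_{\rm nc},\mathcal L(\mathcal Y)_{\rm nc})$ such that $\widehat K(Z,W)(P)=K(Z,W)(P)$ for all $n,m\ge1$, $Z\in\Omega_n$, $W\in\Omega_m$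 and $P\in\mathbb S^{n\times m}$. -/

import Mathlib

open scoped ComplexOrder InnerProductSpace

/-! ### Noncommutative points -/

/-- `V_nc`, the disjoint union over `n ≥ 1` of the square matrices of size `n` over `V`. -/
abbrev NCSpace (V : Type*) := Σ n : ℕ+, Matrix (Fin n) (Fin n) V

/-- The size of a point of `V_nc`. -/
abbrev NCSpace.size {V : Type*} (Z : NCSpace V) : ℕ := Z.1

/-- The matrix underlying a point of `V_nc`. -/
abbrev NCSpace.mat {V : Type*} (Z : NCSpace V) : Matrix (Fin Z.size) (Fin Z.size) V := Z.2

section ModuleAction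

variable {l m n : Type*} [Fintype m] {E : Type*} [AddCommGroup E] [Module ℂ E]

/-- The product `α X` of a complex matrix `α` with a matrix `X` over a complex vector space. -/
def lmul (α : Matrix l m ℂ) (X : Matrix m n E) : Matrix l n E :=
  Matrix.of fun i k => ∑ j, α i j • X j k

/-- The product `X β` of a matrix `X` over a complex vector space with a complex matrix `β`. -/
def rmul (X : Matrix l m E) (β : Matrix m n ℂ) : Matrix l n E :=
  Matrix.of fun i k => ∑ j, β j k • X i j

end ModuleAction

/-! ### Noncommutative kernels -/

/-- Graded functions `K` on `Ω × Ω` with values in `L(E_nc, B_nc)`: for `Z ∈ Ω` of size `n` and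
`W ∈ Ω` of size `m`, the value `K Z W` is a linear map from `E^{n × m}` to `B^{n × m}`. -/
abbrev GradedKernel {V : Type*} (Ω : Set (NCSpace V)) (E B : Type*)
    [AddCommGroup E] [Module ℂ E] [AddCommGroup B] [Module ℂ B] :=
  ∀ Z W : Ω, Matrix (Fin Z.1.size) (Fin W.1.size) E →ₗ[ℂ] Matrix (Fin Z.1.size) (Fin W.1.size) B

/-- A graded function on `Ω × Ω` is a nc kernel if it respects intertwinings. -/
def IsNCKernel {V : Type*} [AddCommGroup V] [Module ℂ V] {Ω : Set (NCSpace V)} {E B : Type*}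
    [AddCommGroup E] [Module ℂ E] [AddCommGroup B] [Module ℂ B] (K : GradedKernel Ω E B) : Prop :=
  ∀ (Z Z' W W' : Ω) (α : Matrix (Fin Z'.1.size) (Fin Z.1.size) ℂ)
    (β : Matrix (Fin W'.1.size) (Fin W.1.size) ℂ),
    lmul α Z.1.mat = rmul Z'.1.mat α → lmul β W.1.mat = rmul W'.1.mat β →
    ∀ P : Matrix (Fin Z.1.size) (Fin W.1.size) E,
      rmul (lmul α (K Z W P)) β.conjTranspose = K Z' W' (rmul (lmul α P) β.conjTranspose)

/-! ### Complete positivity -/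

/-- `S` is an operator system in the unital C*-algebra `A`: a linear subspace which contains the
unit and is closed under the adjoint. -/
structure IsOperatorSystem {A : Type*} [CStarAlgebra A] (S : Submodule ℂ A) : Prop where
  one_mem : (1 : A) ∈ S
  star_mem : ∀ a ∈ S, star a ∈ S

/-- Positivity of an element of a C*-algebra: it has the form `b* b`. This is used for the
C*-algebras of square matrices over a C*-algebra `A`. -/
def IsPosElement {R : Type*} [Mul R] [Star R] (x : R) : Prop := ∃ b : R, x = star b * b

/-- Positivity of a square matrix `[T_ij]` of bounded operators on `Y`, viewed as an operator on
the direct sum of copies of `Y`: `∑ ⟨T_ij y_j, y_i⟩ ≥ 0` for all `y` (Mathlib's inner product is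
conjugate-linear in its first argument). -/
def IsPosOperatorMatrix {I Y : Type*} [Fintype I] [NormedAddCommGroup Y] [InnerProductSpace ℂ Y]
    (T : Matrix I I (Y →L[ℂ] Y)) : Prop :=
  ∀ y : I → Y, 0 ≤ ∑ i, ∑ j, ⟪y i, T i j (y j)⟫_ℂ

/-- Complete positivity of a linear map `Φ : E^{I × I} → L(Y)^{I × I}`, where the matrices over `E`
are ordered through an embedding `ι` of `E` in a C*-algebra `A` (the inclusion of an operator
system, or the identity of `A`): for every `k`, if the `k × k` matrix `[P_pq]` over `E^{I × I}` is
positive in the C*-algebra of `k × k` matrices over `A^{I × I}`, then `[Φ(P_pq)]` is positive. -/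
def IsCompletelyPositive {I E A Y : Type*} [Fintype I] [AddCommGroup E] [Module ℂ E]
    [CStarAlgebra A] [NormedAddCommGroup Y] [InnerProductSpace ℂ Y] (ι : E →ₗ[ℂ] A)
    (Φ : Matrix I I E →ₗ[ℂ] Matrix I I (Y →L[ℂ] Y)) : Prop :=
  ∀ (k : ℕ) (P : Matrix (Fin k) (Fin k) (Matrix I I E)),
    IsPosElement (P.map fun X => X.map ι) →
    IsPosOperatorMatrix (Matrix.comp (Fin k) (Fin k) I I (Y →L[ℂ] Y) (P.map Φ))

/-- For points `Z_1, …, Z_r` of `Ω`, the linear map `[P_ij] ↦ [K(Z_i, Z_j)(P_ij)]` on matrices of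
size `n_1 + … + n_r`, organized in blocks of size `n_i × n_j`. -/
def GradedKernel.blockMap {V : Type*} {Ω : Set (NCSpace V)} {E B : Type*}
    [AddCommGroup E] [Module ℂ E] [AddCommGroup B] [Module ℂ B] (K : GradedKernel Ω E B)
    {r : ℕ} (Z : Fin r → Ω) :
    Matrix (Σ i, Fin (Z i).1.size) (Σ i, Fin (Z i).1.size) E →ₗ[ℂ]
      Matrix (Σ i, Fin (Z i).1.size) (Σ i, Fin (Z i).1.size) B where
  toFun P := Matrix.of fun s t =>
    K (Z s.1) (Z t.1) (Matrix.of fun a b => P ⟨s.1, a⟩ ⟨t.1, b⟩) s.2 t.2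
  map_add' P Q := by
    ext s t
    exact congrFun (congrFun (map_add (K (Z s.1) (Z t.1)) (Matrix.of fun a b => P ⟨s.1, a⟩ ⟨t.1, b⟩)
      (Matrix.of fun a b => Q ⟨s.1, a⟩ ⟨t.1, b⟩)) s.2) t.2
  map_smul' c P := by
    ext s t
    exact congrFun (congrFun (map_smul (K (Z s.1) (Z t.1)) c
      (Matrix.of fun a b => P ⟨s.1, a⟩ ⟨t.1, b⟩)) s.2) t.2

/-- `K` is a cp nc kernel: it is a nc kernel and, for all `Z_1, …, Z_r ∈ Ω`, the map
`[P_ij] ↦ [K(Z_i, Z_j)(P_ij)]` is completely positive. -/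
structure IsCPNCKernel {V : Type*} [AddCommGroup V] [Module ℂ V] {Ω : Set (NCSpace V)}
    {E A Y : Type*} [AddCommGroup E] [Module ℂ E] [CStarAlgebra A] [NormedAddCommGroup Y]
    [InnerProductSpace ℂ Y] (ι : E →ₗ[ℂ] A) (K : GradedKernel Ω E (Y →L[ℂ] Y)) : Prop where
  isNCKernel : IsNCKernel K
  completelyPositive : ∀ (r : ℕ) (Z : Fin r → Ω), IsCompletelyPositive ι (K.blockMap Z)

/-! Since `Ω` is finite, the whole kernel can be encoded by finitely many entries, the operators
`K(Z,W)(E_ij ⊗ s)_kl`. They form one family of sesquilinear forms `B s` on `H = (KernelIndex Ω →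
Y)`, and complete positivity of `K` makes this family completely positive (`IsCPNCKernel.isCPForm`).

Such a family extends from `S` to `A` by Arveson's theorem (`IsCPForm.exists_extension`): in a basis
of `H` it is a positive functional on finitely supported matrices over `S`, and M. Riesz's theorem
extends it. This step is purely algebraic and needs no topology on `H`.

The extension fixes only the values on `S`, but `1 ∈ S`, and Cauchy–Schwarz, `|B a h k|² ≤ ‖a‖² B 1
h h · B 1 k k`, lets the unit control everything. Boundedness of `B 1` gives bounded operators
representing the extended forms. The intertwining relations of `K` say that certain vectors are null
for `B 1`; these are then null for every `B a`, so the extended kernel satisfies the same relations.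
-/

/-! ### Extension of positive functionals -/

/-- The M. Riesz extension theorem for complex-linear functionals on a complex vector space with a
conjugation `J` and a cone `C` of `J`-real vectors. -/
theorem exists_extension_nonneg_of_conj {E : Type*} [AddCommGroup E] [Module ℂ E]
    (J : E →ₗ⋆[ℂ] E) (C : AddSubmonoid E)
    (hsmul : ∀ c : ℝ, 0 ≤ c → ∀ x ∈ C, (c : ℂ) • x ∈ C) (hJC : ∀ x ∈ C, J x = x)
    (D : Submodule ℂ E) (hJD : ∀ x ∈ D, J x ∈ D) (L : E →ₗ[ℂ] ℂ)
    (hL : ∀ x ∈ D, x ∈ C → 0 ≤ L x)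
    (hdense : ∀ x, ∃ d ∈ D, d ∈ C ∧ d + (x + J x) ∈ C) :
    ∃ F : E →ₗ[ℂ] ℂ, (∀ x ∈ D, F x = L x) ∧ ∀ x ∈ C, 0 ≤ F x := by
  -- `x + J x` is a difference of two elements of `C ∩ D`, where `L` is real. Applied to `I • x`,
  -- this gives the equality of real parts below.
  have himL : ∀ x ∈ D, (L (x + J x)).im = 0 := by
    intro x hx
    obtain ⟨d, hdD, hdC, hd⟩ := hdense x
    have h1 := (Complex.le_def.1 (hL _ hdD hdC)).2
    have h2 := (Complex.le_def.1 (hL _ (D.add_mem hdD (D.add_mem hx (hJD x hx))) hd)).2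
    rw [map_add, Complex.add_im, ← h1] at h2
    simpa using h2.symm
  have hreL : ∀ x ∈ D, (L (J x)).re = (L x).re := by
    intro x hx
    have h := himL (Complex.I • x) (D.smul_mem _ hx)
    simp only [LinearMap.map_smulₛₗ, map_add, Complex.conj_I, map_smul, smul_eq_mul,
      Complex.add_im, Complex.mul_im, Complex.I_re, Complex.I_im, Complex.neg_im, map_neg,
      neg_smul, zero_mul, one_mul, zero_add] at h
    linarith
  have hrs : ∀ (c : ℝ) (x : E), c • x = (c : ℂ) • x := fun c x => rfl
  -- This real cone contains `C` and, with both signs, every `J`-skew vector. A real functional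
  -- nonnegative on it therefore vanishes on skew vectors.
  let s : PointedCone ℝ E :=
    { carrier := {x | x + J x ∈ C}
      zero_mem' := by simp
      add_mem' := by
        intro a b ha hb
        have := C.add_mem ha hb
        simp only [Set.mem_ofPred_eq, map_add]
        convert this using 1
        abel
      smul_mem' := by
        rintro ⟨c, hc⟩ x hx
        have := hsmul c hc _ hx
        change c • x + J (c • x) ∈ C
        rw [hrs, LinearMap.map_smulₛₗ, Complex.conj_ofReal, ← smul_add]
        exact this }
  let f : E →ₗ.[ℝ] ℝ :=
    ⟨D.restrictScalars ℝ, (Complex.reLm ∘ₗ L.restrictScalars ℝ) ∘ₗ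
      (D.restrictScalars ℝ).subtype⟩
  have hf : ∀ x : f.domain, f x = (L x).re := fun x => rfl
  obtain ⟨g, hg, hgs⟩ := riesz_extension s f
    (by
      rintro ⟨x, hx⟩ hxs
      rw [hf]
      have hx' : x ∈ D := hx
      have h := (Complex.le_def.1 (hL _ (D.add_mem hx' (hJD x hx')) hxs)).1
      rw [map_add, Complex.add_re, hreL x hx', Complex.zero_re] at h
      change 0 ≤ (L x).re
      linarith)
    (by
      intro y
      obtain ⟨d, hdD, hdC, hd⟩ := hdense y
      refine ⟨⟨((1 / 2 : ℝ) : ℂ) • d, D.smul_mem _ hdD⟩, ?_⟩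
      change ((1 / 2 : ℝ) : ℂ) • d + y + J (((1 / 2 : ℝ) : ℂ) • d + y) ∈ C
      rw [map_add, LinearMap.map_smulₛₗ, Complex.conj_ofReal, hJC d hdC]
      convert hd using 1
      have : d = ((1 / 2 : ℝ) : ℂ) • d + ((1 / 2 : ℝ) : ℂ) • d := by
        rw [← add_smul]; norm_num
      nth_rewrite 3 [this]
      abel)
  have hskew : ∀ x, J x = -x → g x = 0 := by
    intro x hx
    have h1 := hgs x (by change x + J x ∈ C; simp [hx])
    have h2 := hgs (-x) (by change -x + J (-x) ∈ C; simp [hx])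
    rw [map_neg] at h2
    linarith
  -- The complexification is `g x - i g(ix)`. For `x ∈ C` the vector `ix` is skew, so only `g x`
  -- remains.
  refine ⟨Module.Dual.extendRCLike g, fun x hx => ?_, fun x hx => ?_⟩
  · rw [Module.Dual.extendRCLike_apply]
    have h1 : g x = (L x).re := hg ⟨x, hx⟩
    have h2 : g ((RCLike.I : ℂ) • x) = (L (Complex.I • x)).re := hg ⟨_, D.smul_mem _ hx⟩
    rw [h1, h2]
    apply Complex.ext <;> simp
  · rw [Module.Dual.extendRCLike_apply]
    have h1 : g ((RCLike.I : ℂ) • x) = 0 := hskew _ (by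
      rw [LinearMap.map_smulₛₗ, hJC x hx]; simp)
    have h2 : 0 ≤ g x := hgs x (by
      change x + J x ∈ C
      rw [hJC x hx]
      exact C.add_mem hx hx)
    rw [h1]
    simpa using h2

theorem exists_star_mul_self_eq_norm_sq_sub {A : Type*} [CStarAlgebra A] (a : A) :
    ∃ w : A, star w * w = ((‖a‖ ^ 2 : ℝ) : ℂ) • (1 : A) - star a * a := by
  let := CStarAlgebra.spectralOrder A
  let := CStarAlgebra.spectralOrderedRing A
  have h : 0 ≤ (algebraMap ℝ A) (‖a‖ ^ 2) - star a * a :=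
    sub_nonneg.2 CStarAlgebra.star_mul_le_algebraMap_norm_sq
  obtain ⟨w, hw⟩ := CStarAlgebra.nonneg_iff_eq_star_mul_self.1 h
  refine ⟨w, ?_⟩
  rw [← hw, Algebra.algebraMap_eq_smul_one]
  rfl

/-! ### Completely positive families of sesquilinear forms -/

/-- Complete positivity of a linear family of sesquilinear forms on `H`, indexed by a space `E` that
is embedded in a C*-algebra `A` by `ι`. -/
def IsCPForm {E A H : Type*} [AddCommGroup E] [Module ℂ E] [CStarAlgebra A] [AddCommGroup H]
    [Module ℂ H] (ι : E →ₗ[ℂ] A) (B : E →ₗ[ℂ] H →ₗ⋆[ℂ] H →ₗ[ℂ] ℂ) : Prop :=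
  ∀ (m n : ℕ) (v : Fin m → Fin n → A) (h : Fin n → H) (u : Fin n → Fin n → E),
    (∀ p q, ι (u p q) = ∑ t, star (v t p) * v t q) → 0 ≤ ∑ p, ∑ q, B (u p q) (h p) (h q)

section Forms

variable {E A H : Type*} [AddCommGroup E] [Module ℂ E] [CStarAlgebra A] [AddCommGroup H]
  [Module ℂ H]

theorem IsCPForm.sum_nonneg {ι : E →ₗ[ℂ] A} {B : E →ₗ[ℂ] H →ₗ⋆[ℂ] H →ₗ[ℂ] ℂ}
    (hB : IsCPForm ι B) {T G : Type*} [Fintype T] [Fintype G] (v : T → G → A) (h : G → H)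
    (u : G → G → E) (hu : ∀ p q, ι (u p q) = ∑ t, star (v t p) * v t q) :
    0 ≤ ∑ p, ∑ q, B (u p q) (h p) (h q) := by
  let eT := Fintype.equivFin T
  let eG := Fintype.equivFin G
  have := hB _ _ (fun t p => v (eT.symm t) (eG.symm p)) (fun p => h (eG.symm p))
    (fun p q => u (eG.symm p) (eG.symm q)) (fun p q => by
      rw [hu, ← eT.symm.sum_comp])
  rw [← eG.symm.sum_comp]
  simp_rw [← eG.symm.sum_comp (fun q => B (u _ q) _ (h q))]
  exact this

end Forms

/-! ### Finitely supported matrices over a C*-algebra -/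

section FinsuppMatrix

variable {I A : Type*} [CStarAlgebra A]

/-- The finitely supported matrix `[v_i* w_j]`. -/
noncomputable def outerStar (v w : I →₀ A) : I × I →₀ A :=
  Finsupp.onFinset (v.support ×ˢ w.support) (fun p => star (v p.1) * w p.2) fun p hp => by
    rw [Finset.mem_product, Finsupp.mem_support_iff, Finsupp.mem_support_iff]
    constructor <;> rintro h <;> simp [h] at hp

@[simp] theorem outerStar_apply (v w : I →₀ A) (p : I × I) :
    outerStar v w p = star (v p.1) * w p.2 := rfl

theorem outerStar_add_left (v v' w : I →₀ A) :
    outerStar (v + v') w = outerStar v w + outerStar v' w := by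
  ext p; simp [add_mul]

theorem outerStar_add_right (v w w' : I →₀ A) :
    outerStar v (w + w') = outerStar v w + outerStar v w' := by
  ext p; simp [mul_add]

theorem outerStar_single (i j : I) (a b : A) :
    outerStar (Finsupp.single i a) (Finsupp.single j b) = Finsupp.single (i, j) (star a * b) := by
  classical
  ext ⟨p, q⟩
  simp only [outerStar_apply, Finsupp.single_apply, Prod.mk.injEq]
  split_ifs <;> simp_all

/-- The adjoint of finitely supported matrices. -/
noncomputable def finsuppAdjoint (I A : Type*) [CStarAlgebra A] :
    (I × I →₀ A) →ₗ⋆[ℂ] (I × I →₀ A) where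
  toFun M := (M.mapRange star (star_zero A)).equivMapDomain (Equiv.prodComm I I)
  map_add' M N := by ext p; simp
  map_smul' c M := by ext p; simp

@[simp] theorem finsuppAdjoint_apply (M : I × I →₀ A) (p : I × I) :
    finsuppAdjoint I A M p = star (M p.swap) := rfl

theorem finsuppAdjoint_outerStar (v w : I →₀ A) :
    finsuppAdjoint I A (outerStar v w) = outerStar w v := by
  ext p; simp

theorem finsuppAdjoint_single (i j : I) (a : A) :
    finsuppAdjoint I A (Finsupp.single (i, j) a) = Finsupp.single (j, i) (star a) := by
  classical
  ext ⟨p, q⟩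
  simp only [finsuppAdjoint_apply, Finsupp.single_apply, Prod.mk.injEq, Prod.swap_prod_mk]
  split_ifs <;> simp_all

/-- The cone of the finitely supported matrices that are sums of matrices `[v_i* v_j]`. -/
noncomputable def finsuppCone (I A : Type*) [CStarAlgebra A] : AddSubmonoid (I × I →₀ A) where
  carrier := {M | ∃ (m : ℕ) (v : Fin m → I →₀ A), M = ∑ t, outerStar (v t) (v t)}
  zero_mem' := ⟨0, Fin.elim0, by simp⟩
  add_mem' := by
    rintro _ _ ⟨m, v, rfl⟩ ⟨n, w, rfl⟩
    exact ⟨m + n, Fin.append v w, by simp [Fin.sum_univ_add]⟩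

theorem outerStar_self_mem_finsuppCone (v : I →₀ A) : outerStar v v ∈ finsuppCone I A :=
  ⟨1, fun _ => v, by simp⟩

theorem smul_mem_finsuppCone {c : ℝ} (hc : 0 ≤ c) {M : I × I →₀ A} (hM : M ∈ finsuppCone I A) :
    (c : ℂ) • M ∈ finsuppCone I A := by
  obtain ⟨m, v, rfl⟩ := hM
  refine ⟨m, fun t => ((√c : ℝ) : ℂ) • v t, ?_⟩
  rw [Finset.smul_sum]
  refine Finset.sum_congr rfl fun t _ => ?_
  ext p
  simp only [Finsupp.smul_apply, outerStar_apply, star_smul, smul_mul_smul_comm,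
    RCLike.star_def, Complex.conj_ofReal, ← Complex.ofReal_mul, Real.mul_self_sqrt hc]

theorem finsuppAdjoint_of_mem_finsuppCone {M : I × I →₀ A} (hM : M ∈ finsuppCone I A) :
    finsuppAdjoint I A M = M := by
  obtain ⟨m, v, rfl⟩ := hM
  simp [finsuppAdjoint_outerStar]

/-- The finitely supported matrices with entries in a subspace. -/
def finsuppEntries (I : Type*) (S : Submodule ℂ A) : Submodule ℂ (I × I →₀ A) where
  carrier := {M | ∀ p, M p ∈ S}
  zero_mem' _ := S.zero_mem
  add_mem' hM hN p := S.add_mem (hM p) (hN p)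
  smul_mem' c _ hM p := S.smul_mem c (hM p)

theorem single_mem_finsuppEntries {S : Submodule ℂ A} (p : I × I) {a : A} (ha : a ∈ S) :
    Finsupp.single p a ∈ finsuppEntries I S := by
  classical
  intro q
  rw [Finsupp.single_apply]
  split_ifs
  exacts [ha, S.zero_mem]

/-- The domination hypothesis of the Riesz extension. For a single entry `a` at `(i, j)`, complete
the square: `E_ii + E_ij a + E_ji a* + E_jj a*a` comes from the row `e_i + a e_j`, and `‖a‖² - a*a`
is again of the form `w* w`. The dominating matrix involves only multiples of `1`, hence has entries
in `S`. -/
theorem exists_add_mem_finsuppCone {S : Submodule ℂ A} (hS : (1 : A) ∈ S) (M : I × I →₀ A) :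
    ∃ d ∈ finsuppEntries I S, d ∈ finsuppCone I A ∧
      d + (M + finsuppAdjoint I A M) ∈ finsuppCone I A := by
  induction M using Finsupp.induction_linear with
  | zero => exact ⟨0, zero_mem _, zero_mem _, by simp⟩
  | add M N hM hN =>
    obtain ⟨d, h1, h2, h3⟩ := hM
    obtain ⟨e, k1, k2, k3⟩ := hN
    refine ⟨d + e, add_mem h1 k1, add_mem h2 k2, ?_⟩
    convert add_mem h3 k3 using 1
    rw [map_add]
    abel
  | single p a =>
    obtain ⟨i, j⟩ := p
    obtain ⟨w, hw⟩ := exists_star_mul_self_eq_norm_sq_sub a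
    have hone : ∀ i : I, Finsupp.single (i, i) (1 : A) ∈ finsuppCone I A := fun i => by
      have := outerStar_self_mem_finsuppCone (Finsupp.single i (1 : A))
      rwa [outerStar_single, star_one, one_mul] at this
    refine ⟨Finsupp.single (i, i) 1 + ((‖a‖ ^ 2 : ℝ) : ℂ) • Finsupp.single (j, j) 1,
      add_mem (single_mem_finsuppEntries _ hS)
        (Submodule.smul_mem _ _ (single_mem_finsuppEntries _ hS)),
      add_mem (hone i) (smul_mem_finsuppCone (by positivity) (hone j)), ?_⟩
    convert add_mem
      (outerStar_self_mem_finsuppCone (Finsupp.single i (1 : A) + Finsupp.single j a))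
      (outerStar_self_mem_finsuppCone (Finsupp.single j w)) using 1
    simp only [outerStar_add_left, outerStar_add_right, outerStar_single, finsuppAdjoint_single,
      hw, star_one, one_mul, mul_one, Finsupp.single_sub, Finsupp.smul_single]
    abel

end FinsuppMatrix

/-! ### Arveson extension: forms on `H` as functionals on matrices over `A`. -/

section Extension

variable {A H : Type*} [CStarAlgebra A] [AddCommGroup H] [Module ℂ H]

/-- The finitely supported matrix `[conj(h_i) k_j a]` of coordinates with respect to a basis. -/
noncomputable def basisTensor {I : Type*} (b : Module.Basis I ℂ H) (a : A) (h k : H) :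
    I × I →₀ A :=
  Finsupp.onFinset ((b.repr h).support ×ˢ (b.repr k).support)
    (fun p => (star (b.repr h p.1) * b.repr k p.2) • a) fun p hp => by
      rw [Finset.mem_product, Finsupp.mem_support_iff, Finsupp.mem_support_iff]
      constructor <;> rintro h <;> simp [h] at hp

@[simp] theorem basisTensor_apply {I : Type*} (b : Module.Basis I ℂ H) (a : A) (h k : H)
    (p : I × I) : basisTensor b a h k p = (star (b.repr h p.1) * b.repr k p.2) • a := rfl

/-- The family of sesquilinear forms on `H` given by a functional on finitely supported matrices
over `A`, with respect to a basis of `H`. -/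
noncomputable def formOfFunctional {I : Type*} (b : Module.Basis I ℂ H)
    (F : (I × I →₀ A) →ₗ[ℂ] ℂ) : A →ₗ[ℂ] H →ₗ⋆[ℂ] H →ₗ[ℂ] ℂ where
  toFun a := LinearMap.mk₂'ₛₗ (starRingEnd ℂ) (RingHom.id ℂ) (fun h k => F (basisTensor b a h k))
    (fun h h' k => by
      rw [← map_add]; congr 1; ext p; simp [add_mul, add_smul])
    (fun c h k => by
      rw [← map_smul]; congr 1; ext p; simp [mul_assoc, mul_smul])
    (fun h k k' => by
      rw [← map_add]; congr 1; ext p; simp [mul_add, add_smul])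
    (fun c h k => by
      rw [← map_smul]; congr 1; ext p; simp [mul_left_comm, mul_smul])
  map_add' a a' := by
    ext h k
    simp only [LinearMap.mk₂'ₛₗ_apply, LinearMap.add_apply]
    rw [← map_add]; congr 1; ext p; simp
  map_smul' c a := by
    ext h k
    simp only [LinearMap.mk₂'ₛₗ_apply, LinearMap.smul_apply, RingHom.id_apply]
    rw [← map_smul]; congr 1; ext p; simp [smul_comm c]

theorem formOfFunctional_apply {I : Type*} (b : Module.Basis I ℂ H)
    (F : (I × I →₀ A) →ₗ[ℂ] ℂ) (a : A) (h k : H) :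
    formOfFunctional b F a h k = F (basisTensor b a h k) := rfl

/-- The functional on finitely supported matrices over `A` given by a family of sesquilinear
forms. -/
noncomputable def functionalOfForm {I : Type*} (b : Module.Basis I ℂ H)
    (B : A →ₗ[ℂ] H →ₗ⋆[ℂ] H →ₗ[ℂ] ℂ) : (I × I →₀ A) →ₗ[ℂ] ℂ :=
  Finsupp.lsum ℂ fun p =>
    { toFun := fun a => B a (b p.1) (b p.2)
      map_add' := by simp
      map_smul' := by simp }

theorem functionalOfForm_apply {I : Type*} (b : Module.Basis I ℂ H)
    (B : A →ₗ[ℂ] H →ₗ⋆[ℂ] H →ₗ[ℂ] ℂ) (M : I × I →₀ A) (s : Finset I)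
    (hs : M.support ⊆ s ×ˢ s) :
    functionalOfForm b B M = ∑ i ∈ s, ∑ j ∈ s, B (M (i, j)) (b i) (b j) := by
  rw [functionalOfForm, Finsupp.lsum_apply, Finsupp.sum_of_support_subset _ hs _ (by simp),
    Finset.sum_product]
  rfl

theorem functionalOfForm_basisTensor {I : Type*} (b : Module.Basis I ℂ H)
    (B : A →ₗ[ℂ] H →ₗ⋆[ℂ] H →ₗ[ℂ] ℂ) (a : A) (h k : H) :
    functionalOfForm b B (basisTensor b a h k) = B a h k := by
  classical
  rw [functionalOfForm_apply b B _ ((b.repr h).support ∪ (b.repr k).support)]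
  · have hsum : ∀ x : H, ∀ s : Finset I, (b.repr x).support ⊆ s →
        x = ∑ i ∈ s, b.repr x i • b i := fun x s hs => by
      conv_lhs => rw [← b.linearCombination_repr x, Finsupp.linearCombination_apply,
        Finsupp.sum_of_support_subset _ hs _ (by simp)]
    refine Eq.trans ?_ (congrArg₂ (fun x y => B a x y)
      (hsum h ((b.repr h).support ∪ (b.repr k).support) Finset.subset_union_left)
      (hsum k ((b.repr h).support ∪ (b.repr k).support) Finset.subset_union_right)).symm
    simp only [basisTensor_apply, map_sum, LinearMap.sum_apply, map_smul, LinearMap.smul_apply,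
      LinearMap.map_smulₛₗ, smul_eq_mul, RCLike.star_def]
    simp only [Finset.mul_sum]
    rw [Finset.sum_comm]
    refine Finset.sum_congr rfl fun i _ => Finset.sum_congr rfl fun j _ => ?_
    ring
  · intro p hp
    rw [Finsupp.mem_support_iff, basisTensor_apply] at hp
    rw [Finset.mem_product, Finset.mem_union, Finset.mem_union]
    constructor
    · refine Or.inl (Finsupp.mem_support_iff.2 fun h0 => hp (by simp [h0]))
    · refine Or.inr (Finsupp.mem_support_iff.2 fun h0 => hp (by simp [h0]))

/-- **Arveson's extension theorem** for completely positive families of sesquilinear forms. -/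
theorem IsCPForm.exists_extension {S : Submodule ℂ A} (hS : IsOperatorSystem S)
    {B : S →ₗ[ℂ] H →ₗ⋆[ℂ] H →ₗ[ℂ] ℂ} (hB : IsCPForm S.subtype B) :
    ∃ B' : A →ₗ[ℂ] H →ₗ⋆[ℂ] H →ₗ[ℂ] ℂ, IsCPForm (LinearMap.id : A →ₗ[ℂ] A) B' ∧
      ∀ s : S, B' s = B s := by
  classical
  -- An arbitrary linear extension, with no positivity; its values off `S` do not affect the result.
  obtain ⟨B₀, hB₀⟩ := LinearMap.exists_extend B
  have hB₀' : ∀ s : S, B₀ s = B s := fun s => LinearMap.congr_fun hB₀ s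
  let b := Module.Basis.ofVectorSpace ℂ H
  obtain ⟨F, hFL, hF⟩ := exists_extension_nonneg_of_conj
    (finsuppAdjoint (Module.Basis.ofVectorSpaceIndex ℂ H) A) (finsuppCone _ A)
    (fun c hc M hM => smul_mem_finsuppCone hc hM)
    (fun M hM => finsuppAdjoint_of_mem_finsuppCone hM) (finsuppEntries _ S)
    (fun M hM p => hS.star_mem _ (hM _)) (functionalOfForm b B₀)
    (by
      rintro M hMS ⟨m, v, rfl⟩
      set s := Finset.univ.biUnion fun t => (v t).support with hs
      rw [functionalOfForm_apply b B₀ _ s]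
      · have := hB.sum_nonneg (G := s) (fun t p => v t p) (fun p => b p)
          (fun p q => ⟨_, hMS (p, q)⟩) (by simp [Finsupp.finsetSum_apply])
        simp_rw [← hB₀'] at this
        rw [← Finset.sum_coe_sort s]
        simp_rw [← Finset.sum_coe_sort s (fun j => B₀ _ _ (b j))]
        exact this
      · refine (Finsupp.support_finsetSum).trans ?_
        intro p hp
        obtain ⟨t, -, ht⟩ := Finset.mem_biUnion.1 hp
        have := Finsupp.support_onFinset_subset ht
        rw [Finset.mem_product] at this ⊢
        exact ⟨Finset.mem_biUnion.2 ⟨t, Finset.mem_univ _, this.1⟩,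
          Finset.mem_biUnion.2 ⟨t, Finset.mem_univ _, this.2⟩⟩)
    (exists_add_mem_finsuppCone hS.one_mem)
  refine ⟨formOfFunctional b F, ?_, fun s => ?_⟩
  · intro m n v h u hu
    simp_rw [formOfFunctional_apply, ← map_sum]
    -- The row for `t` holds the coordinates of `∑ p, h p ⊗ v t p`.
    refine hF _ ⟨m, fun t => ∑ p, (b.repr (h p)).mapRange (fun c => c • v t p) (by simp), ?_⟩
    ext ⟨i, j⟩
    simp only [LinearMap.id_apply] at hu
    simp only [Finsupp.finsetSum_apply, basisTensor_apply, outerStar_apply, hu,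
      Finsupp.mapRange_apply, star_sum, Finset.sum_mul_sum, star_smul, smul_mul_smul_comm,
      Finset.smul_sum]
    symm
    rw [Finset.sum_comm]
    exact Finset.sum_congr rfl fun p _ => Finset.sum_comm
  · ext h k
    rw [formOfFunctional_apply, hFL, functionalOfForm_basisTensor, hB₀']
    exact fun p => S.smul_mem _ s.2

end Extension

/-! ### Cauchy–Schwarz and representation by bounded operators. -/

section CauchySchwarz

variable {A H : Type*} [CStarAlgebra A] [AddCommGroup H] [Module ℂ H]
  {B : A →ₗ[ℂ] H →ₗ⋆[ℂ] H →ₗ[ℂ] ℂ}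

theorem IsCPForm.apply_star_mul_self_nonneg (hB : IsCPForm (LinearMap.id : A →ₗ[ℂ] A) B) (w : A)
    (h : H) : 0 ≤ B (star w * w) h h := by
  simpa using hB.sum_nonneg (T := Unit) (G := Unit) (fun _ _ => w) (fun _ => h)
    (fun _ _ => star w * w) (by simp)

theorem IsCPForm.two_by_two_nonneg (hB : IsCPForm (LinearMap.id : A →ₗ[ℂ] A) B) (a : A)
    (h k : H) : 0 ≤ B 1 h h + B a h k + (B (star a) k h + B (star a * a) k k) := by
  simpa [Fin.sum_univ_two] using hB.sum_nonneg (T := Unit) (G := Fin 2) (fun _ => ![1, a]) ![h, k]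
    (fun p q => star (![1, a] p) * ![1, a] q) (by simp)

theorem IsCPForm.apply_star (hB : IsCPForm (LinearMap.id : A →ₗ[ℂ] A) B) (a : A) (h k : H) :
    B (star a) k h = star (B a h k) := by
  -- The two-by-two sum and its diagonal terms are real, so the off-diagonal imaginary parts cancel.
  -- Replacing `k` by `I • k` yields the real parts.
  have him : ∀ (a : A) (h k : H), (B (star a) k h).im = -(B a h k).im := by
    intro a h k
    have h1 := (Complex.le_def.1 (hB.two_by_two_nonneg a h k)).2
    have h2 := (Complex.le_def.1 (hB.apply_star_mul_self_nonneg 1 h)).2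
    have h3 := (Complex.le_def.1 (hB.apply_star_mul_self_nonneg a k)).2
    simp only [star_one, mul_one, Complex.zero_im] at h2
    simp only [Complex.zero_im, Complex.add_im] at h1 h3
    linarith
  apply Complex.ext
  · have := him a h (Complex.I • k)
    simp only [LinearMap.map_smulₛₗ, map_smul, LinearMap.smul_apply, smul_eq_mul, Complex.conj_I,
      Complex.mul_im, Complex.neg_re, Complex.neg_im, Complex.I_re, Complex.I_im] at this
    rw [Complex.star_def, Complex.conj_re]
    linarith
  · rw [Complex.star_def, Complex.conj_im, him]

theorem IsCPForm.apply_one_re_nonneg (hB : IsCPForm (LinearMap.id : A →ₗ[ℂ] A) B) (h : H) :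
    0 ≤ (B 1 h h).re := by
  have := (Complex.le_def.1 (hB.apply_star_mul_self_nonneg 1 h)).1
  simpa using this

theorem IsCPForm.apply_star_mul_self_re_le (hB : IsCPForm (LinearMap.id : A →ₗ[ℂ] A) B) (a : A)
    (h : H) : (B (star a * a) h h).re ≤ ‖a‖ ^ 2 * (B 1 h h).re := by
  obtain ⟨w, hw⟩ := exists_star_mul_self_eq_norm_sq_sub a
  have := (Complex.le_def.1 (hB.apply_star_mul_self_nonneg w h)).1
  rw [hw, map_sub, map_smul, LinearMap.sub_apply, LinearMap.sub_apply, LinearMap.smul_apply,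
    LinearMap.smul_apply, smul_eq_mul, Complex.sub_re, Complex.re_ofReal_mul, Complex.zero_re]
    at this
  linarith

/-- The Cauchy–Schwarz inequality for completely positive families of forms. -/
theorem IsCPForm.norm_sq_le (hB : IsCPForm (LinearMap.id : A →ₗ[ℂ] A) B) (a : A) (h k : H) :
    ‖B a h k‖ ^ 2 ≤ ‖a‖ ^ 2 * (B 1 h h).re * (B 1 k k).re := by
  have hh := hB.apply_one_re_nonneg h
  have hk := hB.apply_one_re_nonneg k
  set z := B a h k with hz
  -- Two-by-two positivity at `τ z̄ k`: the phase `z̄` makes both cross terms equal to `τ ‖z‖²`. The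
  -- discriminant then gives the claim multiplied by `‖z‖²`.
  have hquad : ∀ τ : ℝ, 0 ≤ (‖z‖ ^ 2 * (‖a‖ ^ 2 * (B 1 k k).re)) * (τ * τ) +
      (2 * ‖z‖ ^ 2) * τ + (B 1 h h).re := by
    intro τ
    have h1 := (Complex.le_def.1 (hB.two_by_two_nonneg a h ((τ * star z : ℂ) • k))).1
    have h2 := hB.apply_star_mul_self_re_le a k
    have e1 : (B a h ((τ * star z : ℂ) • k)).re = τ * ‖z‖ ^ 2 := by
      rw [map_smul, smul_eq_mul, ← hz, mul_assoc, Complex.star_def, ← Complex.normSq_eq_conj_mul_self,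
        Complex.normSq_eq_norm_sq, ← Complex.ofReal_mul, Complex.ofReal_re]
    have e2 : (B (star a) ((τ * star z : ℂ) • k) h).re = τ * ‖z‖ ^ 2 := by
      rw [hB.apply_star, Complex.star_def, Complex.conj_re, ← e1, Complex.star_def]
    have e3 : (B (star a * a) ((τ * star z : ℂ) • k) ((τ * star z : ℂ) • k)).re =
        τ * τ * ‖z‖ ^ 2 * (B (star a * a) k k).re := by
      rw [map_smul, LinearMap.map_smulₛₗ, LinearMap.smul_apply, smul_smul, smul_eq_mul,
        Complex.mul_conj, Complex.normSq_eq_norm_sq, Complex.re_ofReal_mul, norm_mul,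
        Complex.star_def, RCLike.norm_conj, Complex.norm_real, mul_pow, Real.norm_eq_abs, sq_abs]
      ring
    rw [Complex.add_re, Complex.add_re, Complex.add_re, e1, e2, e3, Complex.zero_re] at h1
    have h3 := mul_le_mul_of_nonneg_left h2
      (mul_nonneg (mul_self_nonneg τ) (sq_nonneg ‖z‖))
    nlinarith
  have hd := discrim_le_zero hquad
  rw [discrim] at hd
  rcases eq_or_lt_of_le (sq_nonneg ‖z‖) with h0 | h0
  · rw [← h0]; positivity
  · have : ‖z‖ ^ 2 * ‖z‖ ^ 2 ≤ ‖z‖ ^ 2 * (‖a‖ ^ 2 * (B 1 h h).re * (B 1 k k).re) := by nlinarith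
    exact le_of_mul_le_mul_left this h0

/-- This transfers linear relations from the unit to all of `A`. -/
theorem IsCPForm.apply_eq_zero_left (hB : IsCPForm (LinearMap.id : A →ₗ[ℂ] A) B) {h : H}
    (hh : B 1 h h = 0) (a : A) (k : H) : B a h k = 0 := by
  have := hB.norm_sq_le a h k
  rw [hh, Complex.zero_re, mul_zero, zero_mul] at this
  exact norm_eq_zero.1 (pow_eq_zero_iff two_ne_zero |>.1 (le_antisymm this (sq_nonneg _)))

theorem IsCPForm.apply_eq_zero_right (hB : IsCPForm (LinearMap.id : A →ₗ[ℂ] A) B) {k : H}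
    (hk : B 1 k k = 0) (a : A) (h : H) : B a h k = 0 := by
  have := hB.norm_sq_le a h k
  rw [hk, Complex.zero_re, mul_zero] at this
  exact norm_eq_zero.1 (pow_eq_zero_iff two_ne_zero |>.1 (le_antisymm this (sq_nonneg _)))

/-- A completely positive family of forms is given by bounded operators on a Hilbert space mapped
to `H`, if the form at the unit is bounded. -/
theorem IsCPForm.exists_operator {Y : Type*} [NormedAddCommGroup Y] [InnerProductSpace ℂ Y]
    [CompleteSpace Y] (hB : IsCPForm (LinearMap.id : A →ₗ[ℂ] A) B) (J J' : Y →ₗ[ℂ] H) (C C' : ℝ)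
    (hJ : ∀ y, (B 1 (J y) (J y)).re ≤ C * ‖y‖ ^ 2)
    (hJ' : ∀ y, (B 1 (J' y) (J' y)).re ≤ C' * ‖y‖ ^ 2) :
    ∃ φ : A →ₗ[ℂ] Y →L[ℂ] Y, ∀ a y y', ⟪y, φ a y'⟫_ℂ = B a (J y) (J' y') := by
  have hex : ∀ a : A, ∃ T : Y →L[ℂ] Y, ∀ y y', ⟪y, T y'⟫_ℂ = B a (J y) (J' y') := by
    intro a
    let f : Y →ₗ⋆[ℂ] Y →ₗ[ℂ] ℂ := ((B a).comp J).compl₂ J'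
    have hf : ∀ y y', ‖f y y'‖ ≤ √(‖a‖ ^ 2 * |C| * |C'|) * ‖y‖ * ‖y'‖ := by
      intro y y'
      refine le_of_sq_le_sq ?_ (by positivity)
      rw [mul_pow, mul_pow, Real.sq_sqrt (by positivity)]
      calc ‖f y y'‖ ^ 2 ≤ ‖a‖ ^ 2 * (B 1 (J y) (J y)).re * (B 1 (J' y') (J' y')).re :=
            hB.norm_sq_le a (J y) (J' y')
        _ ≤ ‖a‖ ^ 2 * (|C| * ‖y‖ ^ 2) * (|C'| * ‖y'‖ ^ 2) := by
            have h1 := (hJ y).trans (mul_le_mul_of_nonneg_right (le_abs_self C) (sq_nonneg ‖y‖))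
            have h2 := (hJ' y').trans
              (mul_le_mul_of_nonneg_right (le_abs_self C') (sq_nonneg ‖y'‖))
            have h3 := hB.apply_one_re_nonneg (J' y')
            gcongr
        _ = _ := by ring
    -- The representing operator sits in the first slot of the inner product; the adjoint moves it
    -- to the second.
    refine ⟨ContinuousLinearMap.adjoint
      (InnerProductSpace.continuousLinearMapOfBilin (f.mkContinuous₂ _ hf)), fun y y' => ?_⟩
    rw [ContinuousLinearMap.adjoint_inner_right,
      InnerProductSpace.continuousLinearMapOfBilin_apply]
    rfl
  choose φ hφ using hex
  refine ⟨{ toFun := φ, map_add' := fun a a' => ?_, map_smul' := fun c a => ?_ }, hφ⟩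
  · ext y'
    refine ext_inner_left ℂ fun y => ?_
    simp [hφ, inner_add_right]
  · ext y'
    refine ext_inner_left ℂ fun y => ?_
    simp [hφ, inner_smul_right]

end CauchySchwarz

/-! ### From square to rectangular factors. -/

section Padding

variable {I E A Y : Type*} [Fintype I] [AddCommGroup E] [Module ℂ E] [CStarAlgebra A]
  [NormedAddCommGroup Y] [InnerProductSpace ℂ Y]

/-- Complete positivity, tested on matrices `w* w` with rectangular `w`. -/
theorem IsCompletelyPositive.sum_nonneg [Nonempty I] {ι : E →ₗ[ℂ] A}
    {Φ : Matrix I I E →ₗ[ℂ] Matrix I I (Y →L[ℂ] Y)} (hΦ : IsCompletelyPositive ι Φ)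
    {Q T : Type*} [Fintype Q] [Fintype T] (P : Q → Q → Matrix I I E) (w : T → Q → I → A)
    (hP : ∀ p q i j, ι (P p q i j) = ∑ t, star (w t p i) * w t q j) (y : Q → I → Y) :
    0 ≤ ∑ p, ∑ i, ∑ q, ∑ j, ⟪y p i, Φ (P p q) i j (y q j)⟫_ℂ := by
  classical
  obtain ⟨i₀⟩ := ‹Nonempty I›
  -- Pad to a square over `Q ⊕ T`: `P` is extended by zero, and row `t` of `w` becomes inner row
  -- `i₀` of the block row `t`.
  let e := Fintype.equivFin (Q ⊕ T)
  let P₀ : Q ⊕ T → Q ⊕ T → Matrix I I E := Sum.elim (fun p => Sum.elim (P p) 0) 0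
  let b₀ : Q ⊕ T → Q ⊕ T → Matrix I I A := Sum.elim 0 fun t =>
    Sum.elim (fun q => Matrix.of fun s i => if s = i₀ then w t q i else 0) 0
  let y₀ : Q ⊕ T → I → Y := Sum.elim y 0
  have h := hΦ (Fintype.card (Q ⊕ T)) (Matrix.of fun p q => P₀ (e.symm p) (e.symm q))
    ⟨Matrix.of fun p q => b₀ (e.symm p) (e.symm q), by
      ext p q i j
      simp only [Matrix.map_apply, Matrix.of_apply, Matrix.mul_apply, Matrix.star_apply,
        Matrix.sum_apply]
      rw [← e.sum_comp]
      simp only [Equiv.symm_apply_apply, Fintype.sum_sum_type]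
      rcases e.symm p with p | p <;> rcases e.symm q with q | q <;>
        simp [P₀, b₀, hP, Finset.sum_ite_eq', apply_ite star, ite_mul, mul_ite]⟩
    (fun s => y₀ (e.symm s.1) s.2)
  simp only [Fintype.sum_prod_type, Matrix.comp_apply, Matrix.map_apply, Matrix.of_apply] at h
  rw [← e.sum_comp] at h
  simp_rw [← e.sum_comp (fun q => ∑ j, ⟪_, Φ (P₀ _ (e.symm q)) _ j (y₀ (e.symm q) j)⟫_ℂ)] at h
  simpa [Fintype.sum_sum_type, P₀, y₀] using h

end Padding

/-! ### Kernels as families of sesquilinear forms. -/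

section Kernel

variable {V : Type*} {Ω : Set (NCSpace V)}
  {E A Y : Type*} [AddCommGroup E] [Module ℂ E] [CStarAlgebra A]
  [NormedAddCommGroup Y] [InnerProductSpace ℂ Y]

/-- The index set of the entries of all the values of the components of a kernel: an element
consists of a point of `Ω`, an index for the argument and an index for the value. -/
abbrev KernelIndex (Ω : Set (NCSpace V)) := Σ Z : Ω, Fin Z.1.size × Fin Z.1.size

/-- The matrix entries of a graded kernel. -/
def GradedKernel.entry (K : GradedKernel Ω E (Y →L[ℂ] Y)) (x x' : KernelIndex Ω) :
    E →ₗ[ℂ] Y →L[ℂ] Y where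
  toFun s := K x.1 x'.1 (Matrix.single x.2.1 x'.2.1 s) x.2.2 x'.2.2
  map_add' s t := by rw [Matrix.single_add, map_add]; rfl
  map_smul' c s := by rw [← Matrix.smul_single, map_smul]; rfl

/-- The graded kernel with given matrix entries. -/
def GradedKernel.ofEntries (φ : KernelIndex Ω → KernelIndex Ω → E →ₗ[ℂ] Y →L[ℂ] Y) :
    GradedKernel Ω E (Y →L[ℂ] Y) := fun Z W =>
  { toFun := fun P => Matrix.of fun k l => ∑ i, ∑ j, φ ⟨Z, i, k⟩ ⟨W, j, l⟩ (P i j)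
    map_add' := fun P Q => by ext; simp [Finset.sum_add_distrib]
    map_smul' := fun c P => by ext; simp [Finset.smul_sum] }

theorem GradedKernel.ofEntries_apply (φ : KernelIndex Ω → KernelIndex Ω → E →ₗ[ℂ] Y →L[ℂ] Y)
    (Z W : Ω) (P : Matrix (Fin Z.1.size) (Fin W.1.size) E) (k l) :
    GradedKernel.ofEntries φ Z W P k l = ∑ i, ∑ j, φ ⟨Z, i, k⟩ ⟨W, j, l⟩ (P i j) := rfl

theorem GradedKernel.apply_eq_sum_entry (K : GradedKernel Ω E (Y →L[ℂ] Y)) (Z W : Ω)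
    (P : Matrix (Fin Z.1.size) (Fin W.1.size) E) (k l) :
    K Z W P k l = ∑ i, ∑ j, K.entry ⟨Z, i, k⟩ ⟨W, j, l⟩ (P i j) := by
  conv_lhs => rw [Matrix.matrix_eq_sum_single P]
  simp only [map_sum, Matrix.sum_apply]
  rfl

/-- The sesquilinear forms on families of vectors given by matrices of operators. -/
noncomputable def entryForm {X : Type*} [Fintype X] (φ : X → X → E →ₗ[ℂ] Y →L[ℂ] Y) :
    E →ₗ[ℂ] (X → Y) →ₗ⋆[ℂ] (X → Y) →ₗ[ℂ] ℂ where
  toFun s := LinearMap.mk₂'ₛₗ (starRingEnd ℂ) (RingHom.id ℂ)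
    (fun h k => ∑ x, ∑ x', ⟪h x, φ x x' s (k x')⟫_ℂ)
    (fun h h' k => by simp [Finset.sum_add_distrib])
    (fun c h k => by simp [Finset.sum_mul, mul_comm])
    (fun h k k' => by simp [Finset.sum_add_distrib])
    (fun c h k => by simp [Finset.mul_sum])
  map_add' s t := by
    ext1 h; ext1 k
    simp [Finset.sum_add_distrib]
  map_smul' c s := by
    ext1 h; ext1 k
    simp [Finset.mul_sum]

theorem entryForm_apply {X : Type*} [Fintype X] (φ : X → X → E →ₗ[ℂ] Y →L[ℂ] Y) (s : E)
    (h k : X → Y) : entryForm φ s h k = ∑ x, ∑ x', ⟪h x, φ x x' s (k x')⟫_ℂ := rfl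

theorem entryForm_single_left {X : Type*} [Fintype X] [DecidableEq X]
    (φ : X → X → E →ₗ[ℂ] Y →L[ℂ] Y) (s : E) (x : X) (y : Y) (k : X → Y) :
    entryForm φ s (Pi.single x y) k = ∑ x', ⟪y, φ x x' s (k x')⟫_ℂ := by
  rw [entryForm_apply, Finset.sum_eq_single x]
  · simp
  · intro z _ hz
    simp [Pi.single_eq_of_ne hz]
  · simp

theorem entryForm_single {X : Type*} [Fintype X] [DecidableEq X]
    (φ : X → X → E →ₗ[ℂ] Y →L[ℂ] Y) (s : E) (x x' : X) (y y' : Y) :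
    entryForm φ s (Pi.single x y) (Pi.single x' y') = ⟪y, φ x x' s y'⟫_ℂ := by
  rw [entryForm_single_left, Finset.sum_eq_single x']
  · simp
  · intro z _ hz
    simp [Pi.single_eq_of_ne hz]
  · simp

variable [AddCommGroup V] [Module ℂ V]

/-- Complete positivity of a cp nc kernel on a finite set `Ω`, applied to all points of `Ω`. -/
theorem IsCPNCKernel.sum_nonneg [Fintype Ω] {ι : E →ₗ[ℂ] A} {K : GradedKernel Ω E (Y →L[ℂ] Y)}
    (hK : IsCPNCKernel ι K) {Q T : Type*} [Fintype Q] [Fintype T]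
    (P : Q → Q → Matrix (Σ Z : Ω, Fin Z.1.size) (Σ Z : Ω, Fin Z.1.size) E)
    (w : T → Q → (Σ Z : Ω, Fin Z.1.size) → A)
    (hP : ∀ p q i j, ι (P p q i j) = ∑ t, star (w t p i) * w t q j)
    (y : Q → (Σ Z : Ω, Fin Z.1.size) → Y) :
    0 ≤ ∑ p, ∑ s, ∑ q, ∑ t, ⟪y p s,
      K s.1 t.1 (Matrix.of fun a b => P p q ⟨s.1, a⟩ ⟨t.1, b⟩) s.2 t.2 (y q t)⟫_ℂ := by
  rcases isEmpty_or_nonempty (Σ Z : Ω, Fin Z.1.size) with hI | hI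
  · simp
  let Z : Fin (Fintype.card Ω) → Ω := (Fintype.equivFin Ω).symm
  let e : (Σ i, Fin (Z i).1.size) ≃ (Σ Z : Ω, Fin Z.1.size) :=
    Equiv.sigmaCongrLeft (β := fun Z : Ω => Fin Z.1.size) (Fintype.equivFin Ω).symm
  have he : ∀ s, e s = ⟨Z s.1, s.2⟩ := fun s => rfl
  have : Nonempty (Σ i, Fin (Z i).1.size) := e.nonempty
  have h := (hK.completelyPositive _ Z).sum_nonneg
    (fun p q => Matrix.of fun i j => P p q (e i) (e j)) (fun t q i => w t q (e i))
    (fun p q i j => hP p q (e i) (e j)) (fun q i => y q (e i))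
  simp_rw [← e.sum_comp]
  exact h

/-- A Choi-matrix argument: test complete positivity on the blocks `E_{arg x, arg x'} ⊗ u p q`,
indexed by pairs `(p, x)`, against the vectors with sole entry `h p x` at `val x`. The block matrix
factors because `[u p q]` does. -/
theorem IsCPNCKernel.isCPForm [Fintype Ω] {ι : E →ₗ[ℂ] A} {K : GradedKernel Ω E (Y →L[ℂ] Y)}
    (hK : IsCPNCKernel ι K) : IsCPForm ι (entryForm K.entry) := by
  classical
  intro m n v h u hu
  let arg : KernelIndex Ω → Σ Z : Ω, Fin Z.1.size := fun x => ⟨x.1, x.2.1⟩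
  let val : KernelIndex Ω → Σ Z : Ω, Fin Z.1.size := fun x => ⟨x.1, x.2.2⟩
  have key := hK.sum_nonneg (Q := Fin n × KernelIndex Ω) (T := Fin m)
    (fun p q => Matrix.of fun s t =>
      if s = arg p.2 then if t = arg q.2 then u p.1 q.1 else 0 else 0)
    (fun t p s => if s = arg p.2 then v t p.1 else 0)
    (fun p q s t => by
      simp only [Matrix.of_apply, apply_ite star, star_zero, ite_mul, zero_mul, mul_ite, mul_zero]
      split_ifs <;> simp [hu])
    (fun p s => if s = val p.2 then h p.1 p.2 else 0)
  convert key using 1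
  simp only [Fintype.sum_prod_type, entryForm_apply]
  refine Finset.sum_congr rfl fun p _ => ?_
  rw [Finset.sum_comm]
  refine Finset.sum_congr rfl fun x _ => ?_
  rw [Finset.sum_eq_single (val x) (fun s _ hs => by simp [hs]) (by simp)]
  refine Finset.sum_congr rfl fun q _ => Finset.sum_congr rfl fun x' _ => ?_
  rw [Finset.sum_eq_single (val x') (fun s _ hs => by simp [hs]) (by simp)]
  rw [if_pos rfl, if_pos rfl]
  have hsingle : (Matrix.of fun a b => (Matrix.of fun s t =>
      if s = arg x then if t = arg x' then u p q else 0 else 0)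
      (⟨(val x).1, a⟩ : Σ Z : Ω, Fin Z.1.size) (⟨(val x').1, b⟩ : Σ Z : Ω, Fin Z.1.size)) =
      Matrix.single x.2.1 x'.2.1 (u p q) := by
    refine Matrix.ext fun a b => ?_
    rw [Matrix.of_apply, Matrix.of_apply, Matrix.single_apply, ite_and]
    simp only [arg, val, Sigma.mk.injEq, heq_eq_eq, true_and, eq_comm]
  rw [hsingle]
  rfl

end Kernel

section One

variable {m n E : Type*} [Fintype m] [DecidableEq m] [AddCommGroup E] [Module ℂ E]

theorem rmul_one (X : Matrix n m E) : rmul X (1 : Matrix m m ℂ) = X := by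
  ext i j
  simp [rmul, Matrix.one_apply, ite_smul]

theorem one_lmul (X : Matrix m n E) : lmul (1 : Matrix m m ℂ) X = X := by
  ext i j
  simp [lmul, Matrix.one_apply, ite_smul]

end One

/-! ### Intertwining relations as null vectors. -/

section Intertwining

variable {V : Type*} {Ω : Set (NCSpace V)} {E Y : Type*} [AddCommGroup E] [Module ℂ E]
  [NormedAddCommGroup Y] [InnerProductSpace ℂ Y]

/-- The vector which expresses that matrices of operators are compatible with `α`, for an argument
index at `Z` and a value index at `Z'`. -/
noncomputable def intertwiningVector [DecidableEq (KernelIndex Ω)] {Z Z' : Ω}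
    (α : Matrix (Fin Z'.1.size) (Fin Z.1.size) ℂ) (i : Fin Z.1.size) (k' : Fin Z'.1.size) (y : Y) :
    KernelIndex Ω → Y :=
  ∑ k, star (α k' k) • (Pi.single ⟨Z, i, k⟩ y : KernelIndex Ω → Y) -
    ∑ i', star (α i' i) • (Pi.single ⟨Z', i', k'⟩ y : KernelIndex Ω → Y)

theorem IsNCKernel.lmul_apply [AddCommGroup V] [Module ℂ V] {K : GradedKernel Ω E (Y →L[ℂ] Y)}
    (hK : IsNCKernel K) {Z Z' : Ω} {α : Matrix (Fin Z'.1.size) (Fin Z.1.size) ℂ}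
    (hα : lmul α Z.1.mat = rmul Z'.1.mat α) (W : Ω)
    (P : Matrix (Fin Z.1.size) (Fin W.1.size) E) :
    lmul α (K Z W P) = K Z' W (lmul α P) := by
  have h := hK Z Z' W W α 1 hα (by rw [one_lmul, rmul_one]) P
  rwa [Matrix.conjTranspose_one, rmul_one, rmul_one] at h

/-- The relation `α K(Z,W)(P) = K(Z',W)(αP)` at `P = E_ij ⊗ s`, read at the entry `(k', l)`. -/
theorem IsNCKernel.sum_smul_entry [AddCommGroup V] [Module ℂ V]
    {K : GradedKernel Ω E (Y →L[ℂ] Y)}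
    (hK : IsNCKernel K) {Z Z' : Ω} {α : Matrix (Fin Z'.1.size) (Fin Z.1.size) ℂ}
    (hα : lmul α Z.1.mat = rmul Z'.1.mat α) (i : Fin Z.1.size) (k' : Fin Z'.1.size)
    (x : KernelIndex Ω) (s : E) :
    ∑ k, α k' k • K.entry ⟨Z, i, k⟩ x s = ∑ i', α i' i • K.entry ⟨Z', i', k'⟩ x s := by
  obtain ⟨W, j, l⟩ := x
  have h := congrFun (congrFun (hK.lmul_apply hα W (Matrix.single i j s)) k') l
  rw [K.apply_eq_sum_entry] at h
  refine Eq.trans h (Finset.sum_congr rfl fun i' _ => ?_)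
  rw [Finset.sum_eq_single j, ← map_smul]
  · congr 1
    simp only [lmul, Matrix.of_apply, Matrix.single_apply, and_true, smul_ite, smul_zero,
      Finset.sum_ite_eq, Finset.mem_univ, if_true]
  · intro j' _ hj'
    simp [lmul, Matrix.single_apply, hj'.symm]
  · simp

variable [Fintype Ω]

/-- The conjugates in `intertwiningVector` are undone by conjugate-linearity, so the pairing
vanishes as soon as the entries satisfy the relation of `IsNCKernel.sum_smul_entry`. -/
theorem entryForm_intertwiningVector_left [DecidableEq (KernelIndex Ω)]
    {φ : KernelIndex Ω → KernelIndex Ω → E →ₗ[ℂ] Y →L[ℂ] Y} {Z Z' : Ω}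
    (α : Matrix (Fin Z'.1.size) (Fin Z.1.size) ℂ) (i : Fin Z.1.size) (k' : Fin Z'.1.size) (y : Y)
    (s : E) (h : KernelIndex Ω → Y) :
    entryForm φ s (intertwiningVector α i k' y) h =
      ∑ x, ⟪y, (∑ k, α k' k • φ ⟨Z, i, k⟩ x s - ∑ i', α i' i • φ ⟨Z', i', k'⟩ x s) (h x)⟫_ℂ := by
  simp only [intertwiningVector, map_sub, map_sum, LinearMap.map_smulₛₗ, LinearMap.sub_apply,
    LinearMap.sum_apply, LinearMap.smul_apply, entryForm_single_left, smul_eq_mul,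
    RCLike.star_def, RingHomCompTriple.comp_apply, sub_apply,
    sum_apply, smul_apply, inner_sub_right, inner_sum,
    inner_smul_right, Finset.sum_sub_distrib, Finset.mul_sum]
  congr 1 <;> exact Finset.sum_comm

end Intertwining

/-! ### Reassembling a kernel from the extended forms. -/

section Main

variable {V : Type*} [AddCommGroup V] [Module ℂ V] {Ω : Set (NCSpace V)}
  {A Y : Type*} [CStarAlgebra A] [NormedAddCommGroup Y] [InnerProductSpace ℂ Y]

/-- Matrices of operators which represent a completely positive family of forms define a cp nc
kernel, if the form at the unit vanishes at the intertwining vectors. -/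
theorem GradedKernel.isCPNCKernel_ofEntries [DecidableEq (KernelIndex Ω)]
    {φ : KernelIndex Ω → KernelIndex Ω → A →ₗ[ℂ] Y →L[ℂ] Y}
    {B : A →ₗ[ℂ] (KernelIndex Ω → Y) →ₗ⋆[ℂ] (KernelIndex Ω → Y) →ₗ[ℂ] ℂ}
    (hB : IsCPForm (LinearMap.id : A →ₗ[ℂ] A) B)
    (hφ : ∀ x x' a y y', ⟪y, φ x x' a y'⟫_ℂ = B a (Pi.single x y) (Pi.single x' y'))
    (hnull : ∀ (Z Z' : Ω) (α : Matrix (Fin Z'.1.size) (Fin Z.1.size) ℂ),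
      lmul α Z.1.mat = rmul Z'.1.mat α → ∀ i k' y,
        B 1 (intertwiningVector α i k' y) (intertwiningVector α i k' y) = 0) :
    IsCPNCKernel (LinearMap.id : A →ₗ[ℂ] A) (GradedKernel.ofEntries φ) := by
  constructor
  · intro Z Z' W W' α β hα hβ P
    have hleft : ∀ i k' x a, ∑ k, α k' k • φ ⟨Z, i, k⟩ x a =
        ∑ i', α i' i • φ ⟨Z', i', k'⟩ x a := by
      intro i k' x a
      ext y'
      refine ext_inner_left ℂ fun y => ?_
      have h := hB.apply_eq_zero_left (hnull Z Z' α hα i k' y) a (Pi.single x y')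
      rw [intertwiningVector] at h
      simp only [map_sub, map_sum, LinearMap.map_smulₛₗ, LinearMap.sub_apply, LinearMap.sum_apply,
        LinearMap.smul_apply, ← hφ, RCLike.star_def, Complex.conj_conj, smul_eq_mul] at h
      simp only [sum_apply, smul_apply, inner_sum,
        inner_smul_right]
      exact sub_eq_zero.1 h
    have hright : ∀ j l' x a, ∑ l, star (β l' l) • φ x ⟨W, j, l⟩ a =
        ∑ j', star (β j' j) • φ x ⟨W', j', l'⟩ a := by
      intro j l' x a
      ext y'
      refine ext_inner_left ℂ fun y => ?_
      have h := hB.apply_eq_zero_right (hnull W W' β hβ j l' y') a (Pi.single x y)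
      rw [intertwiningVector] at h
      simp only [map_sub, map_sum, map_smul, ← hφ, smul_eq_mul] at h
      simp only [sum_apply, smul_apply, inner_sum,
        inner_smul_right]
      exact sub_eq_zero.1 h
    refine Matrix.ext fun k' l' => ?_
    calc rmul (lmul α (GradedKernel.ofEntries φ Z W P)) β.conjTranspose k' l'
        = ∑ l, star (β l' l) • ∑ k, α k' k • ∑ i, ∑ j, φ ⟨Z, i, k⟩ ⟨W, j, l⟩ (P i j) := rfl
      _ = ∑ l, star (β l' l) • ∑ i, ∑ j, ∑ k, α k' k • φ ⟨Z, i, k⟩ ⟨W, j, l⟩ (P i j) := by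
          refine Finset.sum_congr rfl fun l _ => congrArg _ ?_
          simp only [Finset.smul_sum]
          rw [Finset.sum_comm]
          exact Finset.sum_congr rfl fun i _ => Finset.sum_comm
      _ = ∑ i, ∑ j, ∑ i', α i' i • ∑ l, star (β l' l) • φ ⟨Z', i', k'⟩ ⟨W, j, l⟩ (P i j) := by
          simp only [hleft, Finset.smul_sum]
          rw [Finset.sum_comm]
          refine Finset.sum_congr rfl fun i _ => ?_
          rw [Finset.sum_comm]
          refine Finset.sum_congr rfl fun j _ => ?_
          rw [Finset.sum_comm]
          refine Finset.sum_congr rfl fun i' _ => Finset.sum_congr rfl fun l _ => smul_comm _ _ _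
      _ = ∑ i, ∑ j, ∑ i', ∑ j', φ ⟨Z', i', k'⟩ ⟨W', j', l'⟩ (star (β j' j) • α i' i • P i j) := by
          simp only [hright, Finset.smul_sum, map_smul]
          refine Finset.sum_congr rfl fun i _ => Finset.sum_congr rfl fun j _ =>
            Finset.sum_congr rfl fun i' _ => Finset.sum_congr rfl fun l _ => smul_comm _ _ _
      _ = ∑ i', ∑ j', ∑ j, ∑ i, φ ⟨Z', i', k'⟩ ⟨W', j', l'⟩ (star (β j' j) • α i' i • P i j) := by
          rw [Finset.sum_comm]
          simp_rw [fun j => Finset.sum_comm (s := (Finset.univ : Finset (Fin Z.1.size)))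
            (t := (Finset.univ : Finset (Fin Z'.1.size))) (f := fun i i' => ∑ j',
              φ ⟨Z', i', k'⟩ ⟨W', j', l'⟩ (star (β j' j) • α i' i • P i j))]
          rw [Finset.sum_comm]
          refine Finset.sum_congr rfl fun i' _ => ?_
          simp_rw [fun j => Finset.sum_comm (s := (Finset.univ : Finset (Fin Z.1.size)))
            (t := (Finset.univ : Finset (Fin W'.1.size))) (f := fun i j' =>
              φ ⟨Z', i', k'⟩ ⟨W', j', l'⟩ (star (β j' j) • α i' i • P i j))]
          rw [Finset.sum_comm]
      _ = _ := by
          rw [GradedKernel.ofEntries_apply]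
          simp only [rmul, lmul, Matrix.of_apply, Matrix.conjTranspose_apply, Finset.smul_sum,
            map_sum]
  · rintro r Z k P ⟨b, hb⟩ y
    have hentry : ∀ p q s t, P p q s t = ∑ e : Fin k × Σ i, Fin (Z i).1.size,
        star (b e.1 p e.2 s) * b e.1 q e.2 t := by
      intro p q s t
      have := congrFun (congrFun (congrFun (congrFun hb p) q) s) t
      simpa [Matrix.mul_apply, Matrix.sum_apply, Fintype.sum_prod_type] using this
    -- Each index consists of a block `p`, a point `Z i`, an argument index and a value index. The
    -- factor `b` sees only the argument index, the vector `y` only the value index.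
    have h := hB.sum_nonneg (T := Fin k × Σ i, Fin (Z i).1.size)
      (G := Fin k × Σ i, Fin (Z i).1.size × Fin (Z i).1.size)
      (fun e g => b e.1 g.1 e.2 ⟨g.2.1, g.2.2.1⟩)
      (fun g => Pi.single ⟨Z g.2.1, g.2.2⟩ (y (g.1, ⟨g.2.1, g.2.2.2⟩)))
      (fun g g' => P g.1 g'.1 ⟨g.2.1, g.2.2.1⟩ ⟨g'.2.1, g'.2.2.1⟩)
      (fun g g' => hentry _ _ _ _)
    convert h using 1
    simp only [← hφ, Fintype.sum_prod_type, Fintype.sum_sigma, Matrix.comp_apply, Matrix.map_apply,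
      GradedKernel.blockMap, LinearMap.coe_mk, AddHom.coe_mk, Matrix.of_apply,
      GradedKernel.ofEntries_apply, sum_apply, inner_sum]
    refine Finset.sum_congr rfl fun p _ => Finset.sum_congr rfl fun s _ => ?_
    refine Eq.trans ?_ Finset.sum_comm
    refine Finset.sum_congr rfl fun a _ => Eq.trans ?_ Finset.sum_comm
    refine Finset.sum_congr rfl fun q _ => Eq.trans ?_ Finset.sum_comm
    refine Finset.sum_congr rfl fun t _ => Eq.trans Finset.sum_comm ?_
    refine Finset.sum_congr rfl fun i _ => ?_
    rw [Finset.sum_comm]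

end Main

theorem theorem4p1 {V : Type*} [AddCommGroup V] [Module ℂ V]
    {A : Type*} [CStarAlgebra A] (S : Submodule ℂ A) (hS : IsOperatorSystem S)
    {Y : Type*} [NormedAddCommGroup Y] [InnerProductSpace ℂ Y] [CompleteSpace Y]
    (Ω : Set (NCSpace V)) (hΩ : Ω.Finite)
    (K : GradedKernel Ω S (Y →L[ℂ] Y)) (hK : IsCPNCKernel S.subtype K) :
    ∃ Khat : GradedKernel Ω A (Y →L[ℂ] Y),
      IsCPNCKernel (LinearMap.id : A →ₗ[ℂ] A) Khat ∧
      ∀ (Z W : Ω) (P : Matrix (Fin Z.1.size) (Fin W.1.size) S),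
        Khat Z W (P.map fun a => (a : A)) = K Z W P := by
  classical
  let _ : Fintype Ω := hΩ.fintype
  obtain ⟨B, hB, hBK⟩ := hK.isCPForm.exists_extension hS
  -- The unit form is still that of `K`; the bound and the null vectors below both rest on this.
  have hB1 : B 1 = entryForm K.entry (⟨1, hS.one_mem⟩ : S) := hBK ⟨1, hS.one_mem⟩
  have hbound : ∀ (x : KernelIndex Ω) (y : Y),
      (B 1 (Pi.single x y) (Pi.single x y)).re ≤ ‖K.entry x x ⟨1, hS.one_mem⟩‖ * ‖y‖ ^ 2 := by
    intro x y
    rw [hB1, entryForm_single]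
    calc _ ≤ ‖⟪y, K.entry x x ⟨1, hS.one_mem⟩ y⟫_ℂ‖ := Complex.re_le_norm _
      _ ≤ ‖y‖ * (‖K.entry x x ⟨1, hS.one_mem⟩‖ * ‖y‖) := (norm_inner_le_norm _ _).trans
          (mul_le_mul_of_nonneg_left (ContinuousLinearMap.le_opNorm _ _) (norm_nonneg _))
      _ = _ := by ring
  have hφ : ∀ x x' : KernelIndex Ω, ∃ φ : A →ₗ[ℂ] Y →L[ℂ] Y, ∀ a y y',
      ⟪y, φ a y'⟫_ℂ = B a (Pi.single x y) (Pi.single x' y') := fun x x' =>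
    hB.exists_operator (LinearMap.single ℂ (fun _ => Y) x) (LinearMap.single ℂ (fun _ => Y) x')
      _ _ (hbound x) (hbound x')
  choose φ hφ using hφ
  refine ⟨GradedKernel.ofEntries φ, GradedKernel.isCPNCKernel_ofEntries hB hφ ?_, ?_⟩
  · intro Z Z' α hα i k' y
    rw [hB1, entryForm_intertwiningVector_left]
    refine Finset.sum_eq_zero fun x _ => ?_
    rw [hK.isNCKernel.sum_smul_entry hα, sub_self, zero_apply, inner_zero_right]
  · intro Z W P
    refine Matrix.ext fun k l => ?_
    rw [GradedKernel.ofEntries_apply, K.apply_eq_sum_entry]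
    refine Finset.sum_congr rfl fun i _ => Finset.sum_congr rfl fun j _ => ?_
    ext y'
    refine ext_inner_left ℂ fun y => ?_
    rw [hφ, Matrix.map_apply, hBK, entryForm_single]
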